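/- Let $(\Omega,\mathcal F,\mathbb P)$ be a probability space and let $\{x_t\}_{t\in[0,1]}$ be a real Gaussian process on it with $E[x_t]=0$ for all $t\in[0,1]$, with $x_0=x_1$ almost surely, and with $\operatorname{Cov}(x_s,x_t)=\tilde C(t-s)$ for all $s,t\in[0,1]$, where $\tilde C$ is a real function that is continuous on $[-1,1]$. Then there is a real sequence $(c_k)_{k\ge 0}\in\ell^2$ with $$c_n^2=\int_0^1\tilde C(s)\cos(2n\pi s)\,ds,\qquad n=0,1,2,\ldots,$$ and there are two sequences $(Y_k)_k$, $(Y'_k)_k$ of real functions on $\Omega$ such that $$x_t=c_0Y'_0+\sum_{k=1}^\infty c_k\bigl(Y_k\sqrt2\,\sin(2k\pi t)+Y'_k\sqrt2\,\cos(2k\pi t)\bigr)$$ in mean square, uniformly in $t$; that is, if $S_n(t)$ denotes the sum with the series truncated at $k=n$, then $x_t-S_n(t)\in L^2(\mathbb P)$ for all $n,t$ and $\sup_{t\in[0,1]}E\bigl[(x_t-S_n(t))^2\bigr]\to0$ as $n\to\infty$. Here the variables that enter the expansion, namely the families $(Y_k)_{k\ge1,\,c_k\ne0}$ and $(Y'_k)_{k\ge0,\,c_k\ne0}$,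 are two independent families of independent standard Gaussian random variables on $\Omega$. Moreover, after an extension of the probability space, these can be completed to full sequences: there are a probability space $(\Omega',\mathcal F',\mathbb P')$, a measure-preserving map $\pi:\Omega'\to\Omega$, and two independent sequences $(Z_k)_{k\ge0}$, $(Z'_k)_{k\ge0}$ of independent standard Gaussian random variables on $\Omega'$, with $Z_k=Y_k\circ\pi$ whenever $k\ge1$ and $c_k\ne0$ and $Z'_k=Y'_k\circ\pi$ whenever $c_k\ne0$, such that $$x_t\circ\pi=c_0Z'_0+\sum_{k=1}^\infty c_k\bigl(Z_k\sqrt2\,\sin(2k\pi t)+Z'_k\sqrt2\,\cos(2k\pi t)\bigr)$$ in mean square on $\Omega'$, uniformly in $t\in[0,1]$, in the same sense. -/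

import Mathlib

open MeasureTheory ProbabilityTheory Filter Topology
open scoped unitInterval

universe u

/-- The process `x` on `[0,1]` is (weakly) stationary with continuous covariogram `Ct`, that is
`Cov (x_s, x_t) = Ct (t - s)`. Only the values of `Ct` on `[-1,1]` matter. -/
structure HasCovariogram {Ω : Type*} [MeasurableSpace Ω] (x : I → Ω → ℝ) (Ct : ℝ → ℝ)
    (P : Measure Ω) : Prop where
  continuousOn : ContinuousOn Ct (Set.Icc (-1) 1)
  cov_eq : ∀ s t : I, cov[x s, x t; P] = Ct ((t : ℝ) - (s : ℝ))

/-- The class `H`: real Gaussian processes on `[0,1]` with zero mean, continuous stationary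
covariance and `x_0 = x_1` almost surely. -/
structure MemH {Ω : Type*} [MeasurableSpace Ω] (x : I → Ω → ℝ) (P : Measure Ω) : Prop where
  gaussian : IsGaussianProcess x P
  mean_zero : ∀ t : I, ∫ ω, x t ω ∂P = 0
  stationary : ∃ Ct : ℝ → ℝ, HasCovariogram x Ct P
  periodic : x 0 =ᵐ[P] x 1

/-- `Y` and `Y'` are two independent families, each consisting of independent standard Gaussian
random variables. -/
structure IndepStdGaussianFamilies {Ω ι ι' : Type*} [MeasurableSpace Ω] (Y : ι → Ω → ℝ)
    (Y' : ι' → Ω → ℝ) (P : Measure Ω) : Prop where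
  measurable_left : ∀ i, Measurable (Y i)
  measurable_right : ∀ i, Measurable (Y' i)
  law_left : ∀ i, HasLaw (Y i) (gaussianReal 0 1) P
  law_right : ∀ i, HasLaw (Y' i) (gaussianReal 0 1) P
  indep_left : iIndepFun Y P
  indep_right : iIndepFun Y' P
  indep : IndepFun (fun ω i => Y i ω) (fun ω i => Y' i ω) P

/-- `c_0 Y'_0 + ∑_{k=1}^n c_k (Y_k √2 sin (2kπt) + Y'_k √2 cos (2kπt))`. -/
noncomputable def trigPartialSum {Ω : Type*} (c : ℕ → ℝ) (Y Y' : ℕ → Ω → ℝ) (n : ℕ) (t : I)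
    (ω : Ω) : ℝ :=
  c 0 * Y' 0 ω + ∑ k ∈ Finset.Icc 1 n,
    c k * (Y k ω * √2 * Real.sin (2 * k * Real.pi * t)
      + Y' k ω * √2 * Real.cos (2 * k * Real.pi * t))

/-- `S n t → x t` in mean square as `n → ∞`, uniformly in `t ∈ [0,1]`. -/
structure TendstoMeanSquareUniformly {Ω : Type*} [MeasurableSpace Ω] (S : ℕ → I → Ω → ℝ)
    (x : I → Ω → ℝ) (P : Measure Ω) : Prop where
  memLp : ∀ n t, MemLp (fun ω => x t ω - S n t ω) 2 P
  tendsto : TendstoUniformly (fun n t => ∫ ω, (x t ω - S n t ω) ^ 2 ∂P) (fun _ => 0) atTop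

/-!
A process of class `H` is a continuous loop `X` in the Hilbert space `L²(P)` whose Gram kernel
`⟪X s, X t⟫ = D (t - s)` is even, continuous and `1`-periodic. The trigonometric system `eₙ`
diagonalizes convolution with `D`, so the coefficients `∫₀¹ eₙ(t) X(t) dt` are pairwise orthogonal,
and their squared norms are the cosine coefficients of `D`, which are therefore nonnegative. Since
`cos² + sin² = 1`, the squared error of the `N`-th partial sum at `t` does not depend on `t`: it is
`D 0` minus the `N`-th partial sum of the Fourier series of `D` at `0`. Its nonnegativity makes the
coefficients summable, and a continuous function with summable Fourier coefficients is the sum of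
its Fourier series, so the error tends to `0` uniformly.

The coefficients lie in the closed span of the process, all of whose elements are Gaussian because
Gaussian laws are closed under mean square limits; inside such a space orthogonality is
independence. The indices with vanishing coefficient are served by fresh Gaussian variables on a
product space.
-/

section TrigonometricSystem

open Real

theorem integral_cos_two_mul_int_mul_pi_mul_add (n : ℤ) (a : ℝ) :
    ∫ t in (0 : ℝ)..1, cos (2 * n * π * t + a) = if n = 0 then cos a else 0 := by
  split_ifs with hn
  · simp [hn]
  · have hn' : (2 * n * π : ℝ) ≠ 0 := by simp [hn, pi_ne_zero]
    rw [intervalIntegral.integral_comp_mul_add cos hn', integral_cos, mul_zero, zero_add, mul_one,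
      show 2 * n * π + a = a + n * (2 * π) by ring, sin_add_int_mul_two_pi, sub_self, smul_zero]

theorem integral_cos_mul_cos_two_mul_int_mul_pi_mul_add (m n : ℤ) (a b : ℝ) :
    ∫ t in (0 : ℝ)..1, cos (2 * m * π * t + a) * cos (2 * n * π * t + b) =
      ((if m = n then cos (a - b) else 0) + if m = -n then cos (a + b) else 0) / 2 := by
  have product_to_sum (t : ℝ) : cos (2 * m * π * t + a) * cos (2 * n * π * t + b) =
      (cos (2 * (m - n : ℤ) * π * t + (a - b)) + cos (2 * (m + n : ℤ) * π * t + (a + b))) / 2 := by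
    have := two_mul_cos_mul_cos (2 * m * π * t + a) (2 * n * π * t + b)
    push_cast
    ring_nf at this ⊢
    linarith
  simp only [product_to_sum, intervalIntegral.integral_div]
  rw [intervalIntegral.integral_add (Continuous.intervalIntegrable (by fun_prop) _ _)
      (Continuous.intervalIntegrable (by fun_prop) _ _),
    integral_cos_two_mul_int_mul_pi_mul_add, integral_cos_two_mul_int_mul_pi_mul_add]
  simp only [sub_eq_zero, add_eq_zero_iff_eq_neg]

/-- The real trigonometric orthonormal system of `L²(0,1)` indexed by the integers: `√2 cos (2nπt)`
for `n > 0`, the constant `1` for `n = 0` and `√2 sin (2|n|πt)` for `n < 0`. Writing all three as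
phase-shifted cosines lets sines and cosines be treated at once. -/
noncomputable def trigBasis (n : ℤ) (t : ℝ) : ℝ :=
  (if n = 0 then 1 else √2) * cos (2 * n * π * t + if n < 0 then π / 2 else 0)

theorem trigBasis_zero (t : ℝ) : trigBasis 0 t = 1 := by simp [trigBasis]

theorem trigBasis_natCast {k : ℕ} (hk : k ≠ 0) (t : ℝ) :
    trigBasis k t = √2 * cos (2 * k * π * t) := by
  simp [trigBasis, hk, (Nat.cast_nonneg (α := ℤ) k).not_gt]

theorem trigBasis_neg_natCast {k : ℕ} (hk : k ≠ 0) (t : ℝ) :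
    trigBasis (-k) t = √2 * sin (2 * k * π * t) := by
  simp [trigBasis, hk, Nat.pos_iff_ne_zero.2 hk, cos_add_pi_div_two]

@[fun_prop]
theorem continuous_trigBasis (n : ℤ) : Continuous (trigBasis n) := by
  unfold trigBasis
  fun_prop

theorem trigBasis_periodic (n : ℤ) : Function.Periodic (trigBasis n) 1 := fun t => by
  rw [trigBasis, trigBasis, mul_add, mul_one, add_right_comm,
    show 2 * n * π = n * (2 * π) by ring, cos_add_int_mul_two_pi]

theorem integral_trigBasis_mul_trigBasis (m n : ℤ) :
    ∫ t in (0 : ℝ)..1, trigBasis m t * trigBasis n t = if m = n then 1 else 0 := by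
  simp only [trigBasis, mul_mul_mul_comm _ (cos _), intervalIntegral.integral_const_mul,
    integral_cos_mul_cos_two_mul_int_mul_pi_mul_add]
  rcases eq_or_ne m n with rfl | hmn
  · rcases lt_trichotomy m 0 with hm | rfl | hm
    · simp [hm.ne, (by lia : m ≠ -m)]
    · norm_num
    · simp [hm.ne', hm.not_gt, (by lia : m ≠ -m)]
  · rcases eq_or_ne m (-n) with rfl | hmn'
    · rcases lt_or_gt_of_ne (by rintro rfl; simp at hmn : n ≠ 0) with hn | hn
      · simp [hn.ne, hn, hn.not_gt, hmn]
      · simp [hn.ne', hn, hn.not_gt, hmn]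
    · simp [hmn, hmn']

theorem trigBasis_sq_add_trigBasis_neg_sq (n : ℤ) (t : ℝ) :
    trigBasis n t ^ 2 + trigBasis (-n) t ^ 2 = 2 := by
  obtain ⟨k, rfl | rfl⟩ := n.eq_nat_or_neg <;> rcases eq_or_ne k 0 with rfl | hk
  · simp only [Nat.cast_zero, neg_zero, trigBasis_zero]; norm_num
  · rw [trigBasis_natCast hk, trigBasis_neg_natCast hk, mul_pow, mul_pow, ← mul_add,
      cos_sq_add_sin_sq, sq_sqrt zero_le_two, mul_one]
  · simp only [Nat.cast_zero, neg_zero, trigBasis_zero]; norm_num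
  · rw [neg_neg, trigBasis_natCast hk, trigBasis_neg_natCast hk, mul_pow, mul_pow, ← mul_add,
      sin_sq_add_cos_sq, sq_sqrt zero_le_two, mul_one]

theorem sum_mul_trigBasis_sq {a : ℤ → ℝ} (ha : Function.Even a) {s : Finset ℤ}
    (hs : ∀ n ∈ s, -n ∈ s) (t : ℝ) : ∑ n ∈ s, a n * trigBasis n t ^ 2 = ∑ n ∈ s, a n := by
  have reindex : ∑ n ∈ s, a n * trigBasis n t ^ 2 = ∑ n ∈ s, a n * trigBasis (-n) t ^ 2 :=
    Finset.sum_nbij' Neg.neg Neg.neg hs hs (by simp) (by simp) (by simp [ha _])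
  have average : ∑ n ∈ s, a n * trigBasis n t ^ 2 + ∑ n ∈ s, a n * trigBasis (-n) t ^ 2 =
      2 * ∑ n ∈ s, a n := by
    simp only [← Finset.sum_add_distrib, ← mul_add, trigBasis_sq_add_trigBasis_neg_sq,
      ← Finset.sum_mul, mul_comm]
  linarith

end TrigonometricSystem

section PeriodicKernel

open Real

/-- The cosine coefficients of a kernel on `[0,1]`, extended evenly to negative indices so as to
match the indexing of `trigBasis`. -/
noncomputable def cosCoeff (C : ℝ → ℝ) (n : ℤ) : ℝ :=
  ∫ s in (0 : ℝ)..1, C s * cos (2 * n * π * s)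

theorem cosCoeff_even (C : ℝ → ℝ) : Function.Even (cosCoeff C) := fun n => by simp [cosCoeff]

theorem cosCoeff_congr {C D : ℝ → ℝ} (h : Set.EqOn C D (Set.Icc 0 1)) (n : ℤ) :
    cosCoeff C n = cosCoeff D n :=
  intervalIntegral.integral_congr fun s hs => by
    simp only [h (Set.uIcc_of_le (zero_le_one' ℝ) ▸ hs)]

variable {D : ℝ → ℝ}

theorem integral_mul_sin_eq_zero (hD : Function.Even D) (hper : Function.Periodic D 1) (n : ℤ) :
    ∫ s in (0 : ℝ)..1, D s * sin (2 * n * π * s) = 0 := by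
  have reflect (s : ℝ) : D (1 - s) * sin (2 * n * π * (1 - s)) = -(D s * sin (2 * n * π * s)) := by
    rw [hper.sub_eq', hD s, show 2 * n * π * (1 - s) = n * (2 * π) - 2 * n * π * s by ring,
      sin_int_mul_two_pi_sub, mul_neg]
  have h := intervalIntegral.integral_comp_sub_left (a := 0) (b := 1)
    (fun s => D s * sin (2 * n * π * s)) 1
  simp only [reflect, intervalIntegral.integral_neg, sub_self, sub_zero] at h
  linarith

theorem integral_mul_cos_add (hc : Continuous D) (hD : Function.Even D)
    (hper : Function.Periodic D 1) (n : ℤ) (a : ℝ) :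
    ∫ s in (0 : ℝ)..1, D s * cos (2 * n * π * s + a) = cosCoeff D n * cos a := by
  have expand (s : ℝ) : D s * cos (2 * n * π * s + a) =
      D s * cos (2 * n * π * s) * cos a - D s * sin (2 * n * π * s) * sin a := by
    rw [cos_add]; ring
  simp only [expand]
  rw [intervalIntegral.integral_sub (Continuous.intervalIntegrable (by fun_prop) _ _)
      (Continuous.intervalIntegrable (by fun_prop) _ _), intervalIntegral.integral_mul_const,
    intervalIntegral.integral_mul_const, integral_mul_sin_eq_zero hD hper, zero_mul, sub_zero,
    cosCoeff]

theorem integral_trigBasis_mul_comp_sub (hc : Continuous D) (hD : Function.Even D)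
    (hper : Function.Periodic D 1) (n : ℤ) (s : ℝ) :
    ∫ t in (0 : ℝ)..1, trigBasis n t * D (t - s) = cosCoeff D n * trigBasis n s := by
  have hper' : Function.Periodic (fun t => trigBasis n t * D (t - s)) 1 := fun t => by
    simp only [trigBasis_periodic n t, show t + 1 - s = t - s + 1 by ring, hper (t - s)]
  calc ∫ t in (0 : ℝ)..1, trigBasis n t * D (t - s)
      = ∫ t in s..s + 1, trigBasis n t * D (t - s) := by
        simpa using hper'.intervalIntegral_add_eq 0 s
    _ = ∫ u in (0 : ℝ)..1, trigBasis n (u + s) * D u := by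
        simpa [add_comm] using (intervalIntegral.integral_comp_add_right (a := 0) (b := 1)
          (fun t => trigBasis n t * D (t - s)) s).symm
    _ = (if n = 0 then 1 else √2) * ∫ u in (0 : ℝ)..1,
          D u * cos (2 * n * π * u + (2 * n * π * s + if n < 0 then π / 2 else 0)) := by
        rw [← intervalIntegral.integral_const_mul]
        congr 1; ext u
        rw [trigBasis, mul_add, add_assoc]; ring
    _ = cosCoeff D n * trigBasis n s := by
        rw [integral_mul_cos_add hc hD hper, trigBasis]; ring

theorem fourierCoeff_lift_eq_cosCoeff (hc : Continuous D) (hD : Function.Even D)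
    (hper : Function.Periodic D 1) (n : ℤ) :
    fourierCoeff (T := 1) (fun u => (hper.lift u : ℂ)) n = cosCoeff D n := by
  have fourier_mul (s : ℝ) : fourier (-n) (s : AddCircle (1 : ℝ)) • (D s : ℂ) =
      ((D s * cos (2 * n * π * s) : ℝ) : ℂ) -
        ((D s * sin (2 * n * π * s) : ℝ) : ℂ) * Complex.I := by
    rw [fourier_coe_apply, show 2 * (π : ℂ) * Complex.I * (-n : ℤ) * s / (1 : ℝ) =
      (-(2 * n * π * s) : ℝ) * Complex.I by push_cast; ring, Complex.exp_mul_I,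
      ← Complex.ofReal_cos, ← Complex.ofReal_sin, cos_neg, sin_neg, smul_eq_mul]
    push_cast; ring
  rw [fourierCoeff_eq_intervalIntegral _ n 0]
  simp only [Function.Periodic.lift_coe, fourier_mul, zero_add, div_one, one_smul]
  rw [intervalIntegral.integral_sub (Continuous.intervalIntegrable (by fun_prop) _ _)
      (Continuous.intervalIntegrable (by fun_prop) _ _), intervalIntegral.integral_mul_const,
    intervalIntegral.integral_ofReal, intervalIntegral.integral_ofReal,
    integral_mul_sin_eq_zero hD hper, Complex.ofReal_zero, zero_mul, sub_zero, cosCoeff]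

theorem hasSum_cosCoeff (hc : Continuous D) (hD : Function.Even D) (hper : Function.Periodic D 1)
    (hsum : Summable (cosCoeff D)) : HasSum (cosCoeff D) (D 0) := by
  have : Fact ((0 : ℝ) < 1) := ⟨one_pos⟩
  let f : C(AddCircle (1 : ℝ), ℂ) :=
    ⟨fun u => (hper.lift u : ℂ), Complex.continuous_ofReal.comp (hc.quotient_lift _)⟩
  have hf (n : ℤ) : fourierCoeff f n = cosCoeff D n := fourierCoeff_lift_eq_cosCoeff hc hD hper n
  have h := has_pointwise_sum_fourier_series_of_summable (f := f)
    (by simpa only [funext hf, Complex.summable_ofReal] using hsum) ((0 : ℝ) : AddCircle (1 : ℝ))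
  have hf0 : f ((0 : ℝ) : AddCircle (1 : ℝ)) = D 0 := by simp only [f, ContinuousMap.coe_mk,
    Function.Periodic.lift_coe]
  rw [hf0] at h
  rw [← Complex.hasSum_ofReal]
  simpa [hf] using h

end PeriodicKernel

section StationaryLoop

variable {H : Type*} [NormedAddCommGroup H] [InnerProductSpace ℝ H]

/-- A continuous loop in a Hilbert space, written as a `1`-periodic curve, whose Gram kernel
`⟪X s, X t⟫ = D (t - s)` is stationary: the Hilbert space picture of a process of class `H`. -/
structure IsStationaryLoop (X : ℝ → H) (D : ℝ → ℝ) : Prop where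
  continuous_kernel : Continuous D
  periodic : Function.Periodic X 1
  inner_eq : ∀ s t, inner ℝ (X s) (X t) = D (t - s)

/-- The (unnormalized) coefficient `∫₀¹ eₙ(t) X(t) dt` of a curve along the trigonometric system. -/
noncomputable def curveCoeff (X : ℝ → H) (n : ℤ) : H :=
  ∫ t in (0 : ℝ)..1, trigBasis n t • X t

/-- The coefficient `curveCoeff X n` of a loop with kernel `D`, divided by its norm
`√(cosCoeff D n)`; it is `0` where that norm vanishes. -/
noncomputable def normalizedCoeff (X : ℝ → H) (D : ℝ → ℝ) (n : ℤ) : H :=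
  (√(cosCoeff D n))⁻¹ • curveCoeff X n

namespace IsStationaryLoop

variable {X : ℝ → H} {D : ℝ → ℝ}

theorem kernel_eq_inner (h : IsStationaryLoop X D) (u : ℝ) : D u = inner ℝ (X 0) (X u) := by
  rw [h.inner_eq, sub_zero]

theorem kernel_periodic (h : IsStationaryLoop X D) : Function.Periodic D 1 := fun u => by
  rw [h.kernel_eq_inner, h.kernel_eq_inner, h.periodic]

theorem kernel_even (h : IsStationaryLoop X D) : Function.Even D := fun u => by
  rw [h.kernel_eq_inner u, real_inner_comm, h.inner_eq, zero_sub]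

theorem norm_sq_eq (h : IsStationaryLoop X D) (t : ℝ) : ‖X t‖ ^ 2 = D 0 := by
  rw [← real_inner_self_eq_norm_sq, h.inner_eq, sub_self]

theorem continuous (h : IsStationaryLoop X D) : Continuous X := by
  refine continuous_iff_continuousAt.2 fun s => tendsto_iff_norm_sub_tendsto_zero.2 ?_
  have norm_sub_eq (t : ℝ) : ‖X t - X s‖ = √(2 * (D 0 - D (s - t))) := by
    rw [← Real.sqrt_sq (norm_nonneg (X t - X s)), norm_sub_sq_real, h.norm_sq_eq, h.norm_sq_eq,
      h.inner_eq]
    ring_nf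
  have hc := h.continuous_kernel
  have key : Continuous fun t => √(2 * (D 0 - D (s - t))) := by fun_prop
  simpa [norm_sub_eq] using key.tendsto s

variable [CompleteSpace H]

theorem curveCoeff_mem_topologicalClosure_span (h : IsStationaryLoop X D) (n : ℤ) :
    curveCoeff X n ∈ (Submodule.span ℝ (Set.range X)).topologicalClosure := by
  have hX := h.continuous
  have : IsProbabilityMeasure (volume.restrict (Set.Ioc (0 : ℝ) 1)) := ⟨by simp⟩
  rw [curveCoeff, intervalIntegral.integral_of_le zero_le_one]
  refine (Submodule.span ℝ (Set.range X)).topologicalClosure.convex.integral_mem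
    (Submodule.isClosed_topologicalClosure _) (ae_of_all _ fun t => ?_)
    (Continuous.intervalIntegrable (by fun_prop) 0 1).1
  exact Submodule.smul_mem _ _ (Submodule.le_topologicalClosure _
    (Submodule.subset_span (Set.mem_range_self t)))

theorem normalizedCoeff_mem_topologicalClosure_span (h : IsStationaryLoop X D) (n : ℤ) :
    normalizedCoeff X D n ∈ (Submodule.span ℝ (Set.range X)).topologicalClosure :=
  Submodule.smul_mem _ _ (h.curveCoeff_mem_topologicalClosure_span n)

theorem inner_curveCoeff_right (h : IsStationaryLoop X D) (v : H) (n : ℤ) :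
    inner ℝ v (curveCoeff X n) = ∫ t in (0 : ℝ)..1, trigBasis n t * inner ℝ v (X t) := by
  have hX := h.continuous
  rw [curveCoeff, ← innerSL_apply_apply ℝ, ← ContinuousLinearMap.intervalIntegral_comp_comm _
    (Continuous.intervalIntegrable (by fun_prop) 0 1)]
  simp only [map_smul, innerSL_apply_apply, smul_eq_mul]

theorem inner_curveCoeff (h : IsStationaryLoop X D) (s : ℝ) (n : ℤ) :
    inner ℝ (X s) (curveCoeff X n) = cosCoeff D n * trigBasis n s := by
  simp only [h.inner_curveCoeff_right, h.inner_eq,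
    integral_trigBasis_mul_comp_sub h.continuous_kernel h.kernel_even h.kernel_periodic]

theorem inner_curveCoeff_curveCoeff (h : IsStationaryLoop X D) (m n : ℤ) :
    inner ℝ (curveCoeff X m) (curveCoeff X n) = if m = n then cosCoeff D m else 0 := by
  have integrand (t : ℝ) : trigBasis n t * inner ℝ (curveCoeff X m) (X t) =
      cosCoeff D m * (trigBasis m t * trigBasis n t) := by
    rw [real_inner_comm, h.inner_curveCoeff]; ring
  simp only [h.inner_curveCoeff_right, integrand, intervalIntegral.integral_const_mul,
    integral_trigBasis_mul_trigBasis, mul_ite, mul_one, mul_zero]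

theorem norm_curveCoeff_sq (h : IsStationaryLoop X D) (n : ℤ) :
    ‖curveCoeff X n‖ ^ 2 = cosCoeff D n := by
  rw [← real_inner_self_eq_norm_sq, h.inner_curveCoeff_curveCoeff, if_pos rfl]

theorem cosCoeff_nonneg (h : IsStationaryLoop X D) (n : ℤ) : 0 ≤ cosCoeff D n :=
  h.norm_curveCoeff_sq n ▸ sq_nonneg _

theorem norm_curveCoeff (h : IsStationaryLoop X D) (n : ℤ) :
    ‖curveCoeff X n‖ = √(cosCoeff D n) := by
  rw [← h.norm_curveCoeff_sq, Real.sqrt_sq (norm_nonneg _)]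

theorem sqrt_smul_normalizedCoeff (h : IsStationaryLoop X D) (n : ℤ) :
    √(cosCoeff D n) • normalizedCoeff X D n = curveCoeff X n := by
  rw [normalizedCoeff, ← h.norm_curveCoeff]
  rcases eq_or_ne (curveCoeff X n) 0 with h0 | h0
  · simp only [h0, smul_zero]
  · exact smul_inv_smul₀ (norm_ne_zero_iff.2 h0) _

theorem norm_normalizedCoeff (h : IsStationaryLoop X D) {n : ℤ} (hn : √(cosCoeff D n) ≠ 0) :
    ‖normalizedCoeff X D n‖ = 1 := by
  rw [normalizedCoeff, ← h.norm_curveCoeff] at *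
  exact norm_smul_inv_norm (norm_ne_zero_iff.1 hn)

theorem inner_normalizedCoeff_of_ne (h : IsStationaryLoop X D) {m n : ℤ} (hmn : m ≠ n) :
    inner ℝ (normalizedCoeff X D m) (normalizedCoeff X D n) = 0 := by
  simp only [normalizedCoeff, real_inner_smul_left, real_inner_smul_right,
    h.inner_curveCoeff_curveCoeff, if_neg hmn, mul_zero]

/-- Because `cos² + sin² = 1`, the error does not depend on `t`: this is why mean square convergence
of the expansion is automatically uniform. -/
theorem norm_sub_sum_smul_curveCoeff_sq (h : IsStationaryLoop X D) {s : Finset ℤ}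
    (hs : ∀ n ∈ s, -n ∈ s) (t : ℝ) :
    ‖X t - ∑ n ∈ s, trigBasis n t • curveCoeff X n‖ ^ 2 = D 0 - ∑ n ∈ s, cosCoeff D n := by
  have projection_sq : ∑ n ∈ s, cosCoeff D n * trigBasis n t ^ 2 = ∑ n ∈ s, cosCoeff D n :=
    sum_mul_trigBasis_sq (cosCoeff_even D) hs t
  have inner_projection : inner ℝ (X t) (∑ n ∈ s, trigBasis n t • curveCoeff X n) =
      ∑ n ∈ s, cosCoeff D n := by
    simp only [inner_sum, real_inner_smul_right, h.inner_curveCoeff, ← projection_sq]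
    exact Finset.sum_congr rfl fun n _ => by ring
  have norm_projection : ‖∑ n ∈ s, trigBasis n t • curveCoeff X n‖ ^ 2 =
      ∑ n ∈ s, cosCoeff D n := by
    simp only [← real_inner_self_eq_norm_sq, sum_inner, inner_sum, real_inner_smul_left,
      real_inner_smul_right, h.inner_curveCoeff_curveCoeff, mul_ite, mul_zero,
      Finset.sum_ite_eq', ← projection_sq]
    exact Finset.sum_congr rfl fun n hn => by rw [if_pos hn]; ring
  rw [norm_sub_sq_real, inner_projection, norm_projection, h.norm_sq_eq]
  ring

theorem summable_cosCoeff (h : IsStationaryLoop X D) : Summable (cosCoeff D) := by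
  refine summable_of_sum_le h.cosCoeff_nonneg fun s => (?_ : _ ≤ D 0)
  have hs : ∀ n ∈ s ∪ s.image Neg.neg, -n ∈ s ∪ s.image Neg.neg := by
    simp only [Finset.mem_union, Finset.mem_image]
    rintro n (hn | ⟨m, hm, rfl⟩)
    · exact Or.inr ⟨n, hn, rfl⟩
    · exact Or.inl ((neg_neg m).symm ▸ hm)
  calc ∑ n ∈ s, cosCoeff D n ≤ ∑ n ∈ s ∪ s.image Neg.neg, cosCoeff D n :=
        Finset.sum_le_sum_of_subset_of_nonneg Finset.subset_union_left
          fun n _ _ => h.cosCoeff_nonneg n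
    _ ≤ D 0 := sub_nonneg.1 (h.norm_sub_sum_smul_curveCoeff_sq hs 0 ▸ sq_nonneg _)

theorem memℓp_sqrt_cosCoeff (h : IsStationaryLoop X D) :
    Memℓp (fun k : ℕ => √(cosCoeff D k)) 2 := by
  refine memℓp_gen ?_
  simpa [Real.sq_sqrt (h.cosCoeff_nonneg _), Function.comp_def] using
    h.summable_cosCoeff.comp_injective Nat.cast_injective

theorem tendsto_sum_Icc_cosCoeff (h : IsStationaryLoop X D) :
    Tendsto (fun N : ℕ => ∑ n ∈ Finset.Icc (-N : ℤ) N, cosCoeff D n) atTop (𝓝 (D 0)) := by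
  have hsum := hasSum_cosCoeff h.continuous_kernel h.kernel_even h.kernel_periodic
    h.summable_cosCoeff
  rw [HasSum, SummationFilter.unconditional_filter] at hsum
  exact hsum.comp Finset.tendsto_Icc_neg

end IsStationaryLoop

end StationaryLoop

section GaussianSubspace

variable {Ω : Type*} [MeasurableSpace Ω] {P : Measure Ω}

theorem coeFn_sum_smul_ae_eq {ι : Type*} (s : Finset ι) (a : ι → ℝ) (v : ι → Lp ℝ 2 P) :
    (∑ i ∈ s, a i • v i : Lp ℝ 2 P) =ᵐ[P] fun ω => ∑ i ∈ s, a i * v i ω := by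
  filter_upwards [Lp.coeFn_finsetSum s fun i => a i • v i,
    (ae_ball_iff s.countable_toSet).2 fun i _ => Lp.coeFn_smul (a i) (v i)] with ω hsum hsmul
  rw [hsum, Finset.sum_apply]
  exact Finset.sum_congr rfl hsmul

theorem inner_toLp_eq_covariance [IsProbabilityMeasure P] {f g : Ω → ℝ} (hf : MemLp f 2 P)
    (hg : MemLp g 2 P) (hmean : ∫ ω, f ω ∂P = 0) :
    inner ℝ (hf.toLp f) (hg.toLp g) = cov[f, g; P] := by
  rw [covariance_eq_sub hf hg, hmean, zero_mul, sub_zero, L2.inner_def]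
  refine integral_congr_ae ?_
  filter_upwards [hf.coeFn_toLp, hg.coeFn_toLp] with ω hfω hgω
  simp [hfω, hgω, mul_comm]

theorem hasLaw_gaussianReal_zero_nnnorm_sq {v : Lp ℝ 2 P} (hv : HasGaussianLaw v P)
    (hmean : ∫ ω, v ω ∂P = 0) : HasLaw v (gaussianReal 0 (‖v‖₊ ^ 2)) P := by
  refine ⟨hv.aemeasurable, ?_⟩
  have norm_sq : ‖v‖ ^ 2 = ∫ ω, v ω ^ 2 ∂P := by
    rw [← real_inner_self_eq_norm_sq, L2.inner_def]
    simp [sq]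
  rw [hv.map_eq_gaussianReal, variance_eq_integral hv.aemeasurable, hmean]
  simp only [sub_zero, ← norm_sq, Real.toNNReal_pow (norm_nonneg v), norm_toNNReal]

/-- A Gaussian space in the sense of Gaussian Hilbert spaces, not required to be closed: a subspace
of `L²(P)` all of whose elements are centred Gaussian variables. -/
def IsGaussianSubspace (M : Submodule ℝ (Lp ℝ 2 P)) : Prop :=
  ∀ v ∈ M, HasLaw v (gaussianReal 0 (‖v‖₊ ^ 2)) P

theorem isGaussianSubspace_span_toLp {T : Type*} {x : T → Ω → ℝ} (hx : IsGaussianProcess x P)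
    (hmean : ∀ t, ∫ ω, x t ω ∂P = 0) (hL2 : ∀ t, MemLp (x t) 2 P) :
    IsGaussianSubspace (Submodule.span ℝ (Set.range fun t => (hL2 t).toLp (x t))) := by
  intro v hv
  have := hx.isProbabilityMeasure
  obtain ⟨a, rfl⟩ := Finsupp.mem_span_range_iff_exists_finsupp.1 hv
  have ae_eq : (a.sum fun t r => r • (hL2 t).toLp (x t) : Lp ℝ 2 P) =ᵐ[P]
      fun ω => ∑ t ∈ a.support, a t * x t ω := by
    filter_upwards [coeFn_sum_smul_ae_eq a.support a fun t => (hL2 t).toLp (x t),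
      (ae_ball_iff a.support.countable_toSet).2 fun t _ => (hL2 t).coeFn_toLp] with ω hsum htoLp
    exact hsum.trans (Finset.sum_congr rfl fun t ht => by rw [htoLp t ht])
  have gaussian_sum : HasGaussianLaw (fun ω => ∑ t ∈ a.support, a t * x t ω) P :=
    (hx.smul a).hasGaussianLaw_fun_sum
  refine hasLaw_gaussianReal_zero_nnnorm_sq (gaussian_sum.congr ae_eq.symm) ?_
  rw [integral_congr_ae ae_eq, integral_finsetSum _ fun t _ =>
    ((hL2 t).integrable one_le_two).const_mul (a t)]
  simp only [integral_const_mul, hmean, mul_zero, Finset.sum_const_zero]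

theorem isClosed_setOf_hasLaw_gaussianReal_zero_nnnorm_sq [IsProbabilityMeasure P] :
    IsClosed {v : Lp ℝ 2 P | HasLaw v (gaussianReal 0 (‖v‖₊ ^ 2)) P} := by
  refine IsSeqClosed.isClosed fun v w hv hvw => ?_
  have hlaw : TendstoInDistribution (fun n => (v n : Ω → ℝ)) atTop w (fun _ => P) P :=
    (tendstoInMeasure_of_tendsto_Lp hvw).tendstoInDistribution fun n =>
      (Lp.aestronglyMeasurable (v n)).aemeasurable
  have := Measure.isProbabilityMeasure_map hlaw.aemeasurable_limit
  refine ⟨hlaw.aemeasurable_limit, Measure.ext_of_charFun (funext fun t => ?_)⟩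
  have tendsto_map : Tendsto (fun n => charFun (P.map (v n)) t) atTop (𝓝 (charFun (P.map w) t)) :=
    ProbabilityMeasure.tendsto_iff_tendsto_charFun.1 hlaw.tendsto t
  have tendsto_gaussian : Tendsto (fun n => charFun (gaussianReal 0 (‖v n‖₊ ^ 2)) t) atTop
      (𝓝 (charFun (gaussianReal 0 (‖w‖₊ ^ 2)) t)) := by
    have continuous_charFun :
        Continuous fun v : Lp ℝ 2 P => charFun (gaussianReal 0 (‖v‖₊ ^ 2)) t := by
      simp only [charFun_gaussianReal, NNReal.coe_pow, coe_nnnorm]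
      fun_prop
    exact (continuous_charFun.tendsto w).comp hvw
  simp only [fun n => (hv n).map_eq] at tendsto_map
  exact tendsto_nhds_unique tendsto_map tendsto_gaussian

namespace IsGaussianSubspace

variable {M : Submodule ℝ (Lp ℝ 2 P)} {ι : Type*} {v : ι → Lp ℝ 2 P}

theorem topologicalClosure [IsProbabilityMeasure P] (hM : IsGaussianSubspace M) :
    IsGaussianSubspace M.topologicalClosure :=
  closure_minimal hM isClosed_setOf_hasLaw_gaussianReal_zero_nnnorm_sq

theorem isGaussianProcess (hM : IsGaussianSubspace M) (hv : ∀ i, v i ∈ M) :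
    IsGaussianProcess (fun i => (v i : Ω → ℝ)) P := by
  classical
  refine ⟨fun J => ⟨isGaussian_of_map_eq_gaussianReal fun L => ?_⟩⟩
  set a : J → ℝ := fun i => L fun j => if i = j then 1 else 0
  have hL (y : J → ℝ) : L y = ∑ i, a i * y i :=
    (L.toLinearMap.pi_apply_eq_sum_univ y).trans (Finset.sum_congr rfl fun i _ => mul_comm _ _)
  have hw : ∑ i, a i • v i ∈ M := M.sum_mem fun i _ => M.smul_mem _ (hv i)
  have hmeas : Measurable fun ω => J.restrict (fun i => v i ω) :=
    measurable_pi_lambda _ fun i => (Lp.stronglyMeasurable (v i)).measurable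
  refine ⟨0, ‖∑ i, a i • v i‖₊ ^ 2, ?_⟩
  rw [Measure.map_map (by fun_prop) hmeas, ← (hM _ hw).map_eq]
  refine Measure.map_congr ?_
  filter_upwards [coeFn_sum_smul_ae_eq Finset.univ a fun i => v i] with ω hω
  rw [hω, Function.comp_apply, hL]
  rfl

theorem covariance_eq_inner (hM : IsGaussianSubspace M) {v : Lp ℝ 2 P} (hv : v ∈ M)
    (w : Lp ℝ 2 P) : cov[v, w; P] = inner ℝ v w := by
  have := (hM v hv).isProbabilityMeasure
  have hmean : ∫ ω, v ω ∂P = 0 := (hM v hv).integral_eq.trans integral_id_gaussianReal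
  simpa only [Lp.toLp_coeFn] using
    (inner_toLp_eq_covariance (Lp.memLp v) (Lp.memLp w) hmean).symm

theorem iIndepFun (hM : IsGaussianSubspace M) (hv : ∀ i, v i ∈ M)
    (horth : Pairwise fun i j => inner ℝ (v i) (v j) = 0) :
    iIndepFun (fun i => (v i : Ω → ℝ)) P := by
  have h := IsGaussianProcess.iIndepFun_of_covariance_eq_zero (P := P)
    (S := fun _ : ι => Unit) (X := fun i _ => (v i : Ω → ℝ))
    (hM.isGaussianProcess fun p => hv p.1) (fun i _ => (Lp.aestronglyMeasurable (v i)).aemeasurable)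
    fun i j hij _ _ => by rw [hM.covariance_eq_inner (hv i), horth hij]
  exact h.comp (fun _ f => f ()) fun _ => measurable_pi_apply _

theorem hasLaw_of_norm_eq_one (hM : IsGaussianSubspace M) {v : Lp ℝ 2 P} (hv : v ∈ M)
    (hnorm : ‖v‖ = 1) : HasLaw v (gaussianReal 0 1) P := by
  have hnnnorm : ‖v‖₊ = 1 := NNReal.eq hnorm
  simpa [hnnnorm] using hM v hv

end IsGaussianSubspace

end GaussianSubspace

section Independence

universe v w

variable {Ω : Type u} {𝓧 : Type w} [MeasurableSpace Ω] [MeasurableSpace 𝓧] {P : Measure Ω}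

section SumElim

variable {ι ι' : Type*} {Y : ι → Ω → 𝓧} {Y' : ι' → Ω → 𝓧}

theorem indepFun_of_iIndepFun_sumElim (hY : ∀ i, Measurable (Y i)) (hY' : ∀ i, Measurable (Y' i))
    (h : iIndepFun (Sum.elim Y Y') P) :
    IndepFun (fun ω i => Y i ω) (fun ω i => Y' i ω) P := by
  have := h.isProbabilityMeasure
  refine IndepFun.process_indepFun_process hY hY' fun S T => ?_
  have indep_finset := h.indepFun_finset (S.map .inl) (T.map .inr)
    (Finset.disjoint_map_inl_map_inr S T) (Sum.forall.2 ⟨hY, hY'⟩)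
  exact indep_finset.comp
    (φ := fun f (i : S) => f ⟨.inl i, Finset.mem_map_of_mem .inl i.2⟩)
    (ψ := fun f (i : T) => f ⟨.inr i, Finset.mem_map_of_mem .inr i.2⟩)
    (by fun_prop) (by fun_prop)

theorem iIndepFun_sumElim (hY : iIndepFun Y P) (hY' : iIndepFun Y' P)
    (h : IndepFun (fun ω i => Y i ω) (fun ω i => Y' i ω) P) : iIndepFun (Sum.elim Y Y') P := by
  rw [iIndepFun_iff_measure_inter_preimage_eq_mul] at hY hY' ⊢
  intro S A hA
  have hleft (i) (hi : i ∈ S.toLeft) : MeasurableSet (A (.inl i)) := hA _ (Finset.mem_toLeft.1 hi)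
  have hright (i) (hi : i ∈ S.toRight) : MeasurableSet (A (.inr i)) :=
    hA _ (Finset.mem_toRight.1 hi)
  have inter_eq : ⋂ i ∈ S, Sum.elim Y Y' i ⁻¹' A i =
      (fun ω i => Y i ω) ⁻¹' (S.toLeft : Set ι).pi (fun i => A (.inl i)) ∩
        (fun ω i => Y' i ω) ⁻¹' (S.toRight : Set ι').pi (fun i => A (.inr i)) := by
    ext ω; simp
  have left_eq : P ((fun ω i => Y i ω) ⁻¹' (S.toLeft : Set ι).pi (fun i => A (.inl i))) =
      ∏ i ∈ S.toLeft, P (Y i ⁻¹' A (.inl i)) := by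
    rw [← hY S.toLeft hleft]
    congr 1; ext ω; simp
  have right_eq : P ((fun ω i => Y' i ω) ⁻¹' (S.toRight : Set ι').pi (fun i => A (.inr i))) =
      ∏ i ∈ S.toRight, P (Y' i ⁻¹' A (.inr i)) := by
    rw [← hY' S.toRight hright]
    congr 1; ext ω; simp
  rw [inter_eq, h.measure_inter_preimage_eq_mul _ _
    (.pi S.toLeft.countable_toSet hleft) (.pi S.toRight.countable_toSet hright), left_eq, right_eq,
    ← S.toLeft_disjSum_toRight, Finset.prod_disjSum]
  simp

theorem iIndepFun_comp_measurePreserving {Ω' : Type*} [MeasurableSpace Ω'] {P' : Measure Ω'}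
    {π : Ω' → Ω} (hπ : MeasurePreserving π P' P) (hYm : ∀ i, Measurable (Y i))
    (hY : iIndepFun Y P) : iIndepFun (fun i => Y i ∘ π) P' := by
  rw [iIndepFun_iff_measure_inter_preimage_eq_mul] at hY ⊢
  intro S A hA
  have hYA (i) (hi : i ∈ S) : MeasurableSet (Y i ⁻¹' A i) := hYm i (hA i hi)
  calc P' (⋂ i ∈ S, Y i ∘ π ⁻¹' A i) = P' (π ⁻¹' ⋂ i ∈ S, Y i ⁻¹' A i) := by
        simp only [Set.preimage_comp, Set.preimage_iInter]
    _ = ∏ i ∈ S, P (Y i ⁻¹' A i) := by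
        rw [hπ.measure_preimage (S.measurableSet_biInter hYA).nullMeasurableSet, hY S hA]
    _ = ∏ i ∈ S, P' (Y i ∘ π ⁻¹' A i) := Finset.prod_congr rfl fun i hi => by
        rw [Set.preimage_comp, hπ.measure_preimage (hYA i hi).nullMeasurableSet]

theorem iIndepFun_sumElim_comp_fst_snd {Ω' : Type*} [MeasurableSpace Ω'] {Q : Measure Ω'}
    {Y' : ι' → Ω' → 𝓧} (hYm : ∀ i, Measurable (Y i)) (hYm' : ∀ i, Measurable (Y' i))
    (hY : iIndepFun Y P) (hY' : iIndepFun Y' Q) :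
    iIndepFun (Sum.elim (fun i => Y i ∘ Prod.fst) (fun i => Y' i ∘ Prod.snd)) (P.prod Q) := by
  have := hY.isProbabilityMeasure
  have := hY'.isProbabilityMeasure
  exact iIndepFun_sumElim (iIndepFun_comp_measurePreserving measurePreserving_fst hYm hY)
    (iIndepFun_comp_measurePreserving measurePreserving_snd hYm' hY')
    (indepFun_prod (X := fun ω i => Y i ω) (Y := fun ω i => Y' i ω) (by fun_prop) (by fun_prop))

end SumElim

theorem exists_extension_iIndepFun_hasLaw {ι : Type v} (μ : ι → Measure 𝓧)
    [∀ i, IsProbabilityMeasure (μ i)] {p : ι → Prop} {Y : ι → Ω → 𝓧}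
    (hm : ∀ i, p i → Measurable (Y i)) (hlaw : ∀ i, p i → HasLaw (Y i) (μ i) P)
    (hind : iIndepFun (fun i : {i // p i} => Y i) P) :
    ∃ (Ω' : Type max u v w) (_ : MeasurableSpace Ω') (P' : Measure Ω') (_ : IsProbabilityMeasure P')
      (π : Ω' → Ω), MeasurePreserving π P' P ∧ ∃ Z : ι → Ω' → 𝓧, (∀ i, p i → Z i = Y i ∘ π) ∧
        (∀ i, Measurable (Z i)) ∧ (∀ i, HasLaw (Z i) (μ i) P') ∧ iIndepFun Z P' := by
  classical
  have := hind.isProbabilityMeasure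
  let Q : Measure (ι → 𝓧) := Measure.infinitePi μ
  let g (i : ι) : {i // p i} ⊕ ι := if h : p i then .inl ⟨i, h⟩ else .inr i
  have hg : Function.Injective g := by
    intro i j hij
    simp only [g] at hij
    split_ifs at hij <;> simp_all
  let Z (i : ι) : Ω × (ι → 𝓧) → 𝓧 :=
    Sum.elim (fun i : {i // p i} => Y i ∘ Prod.fst) (fun i => (· i) ∘ Prod.snd) (g i)
  have Z_of_pos {i : ι} (hi : p i) : Z i = Y i ∘ Prod.fst := by
    simp only [Z, g, dif_pos hi, Sum.elim_inl]
  have Z_of_neg {i : ι} (hi : ¬p i) : Z i = (· i) ∘ Prod.snd := by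
    simp only [Z, g, dif_neg hi, Sum.elim_inr]
  refine ⟨Ω × (ι → 𝓧), inferInstance, P.prod Q, inferInstance, Prod.fst, measurePreserving_fst, Z,
    fun i hi => Z_of_pos hi, fun i => ?_, fun i => ?_, ?_⟩
  · by_cases hi : p i
    · exact Z_of_pos hi ▸ (hm i hi).comp measurable_fst
    · exact Z_of_neg hi ▸ (measurable_pi_apply i).comp measurable_snd
  · by_cases hi : p i
    · exact Z_of_pos hi ▸ (hlaw i hi).comp measurePreserving_fst.hasLaw
    · exact Z_of_neg hi ▸
        ((measurePreserving_eval_infinitePi μ i).comp measurePreserving_snd).hasLaw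
  · exact (iIndepFun_sumElim_comp_fst_snd (fun i => hm i.1 i.2) measurable_pi_apply hind
      (iIndepFun_infinitePi (P := μ) (X := fun _ r => r) fun _ => measurable_id)).precomp hg

namespace IndepStdGaussianFamilies

theorem of_iIndepFun {ι ι' : Type*} {Y : ι → Ω → ℝ} {Y' : ι' → Ω → ℝ}
    (hm : ∀ i, Measurable (Sum.elim Y Y' i))
    (hlaw : ∀ i, HasLaw (Sum.elim Y Y' i) (gaussianReal 0 1) P)
    (h : iIndepFun (Sum.elim Y Y') P) : IndepStdGaussianFamilies Y Y' P where
  measurable_left i := hm (.inl i)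
  measurable_right i := hm (.inr i)
  law_left i := hlaw (.inl i)
  law_right i := hlaw (.inr i)
  indep_left := h.precomp (g := Sum.inl) Sum.inl_injective
  indep_right := h.precomp (g := Sum.inr) Sum.inr_injective
  indep := indepFun_of_iIndepFun_sumElim (fun i => hm (.inl i)) (fun i => hm (.inr i)) h

theorem exists_extension {ι : Type v} {ι' : Type w} {p : ι → Prop} {p' : ι' → Prop}
    {Y : ι → Ω → ℝ} {Y' : ι' → Ω → ℝ}
    (h : IndepStdGaussianFamilies (fun i : {i // p i} => Y i) (fun i : {i // p' i} => Y' i) P) :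
    ∃ (Ω' : Type max u v w) (_ : MeasurableSpace Ω') (P' : Measure Ω') (_ : IsProbabilityMeasure P')
      (π : Ω' → Ω), MeasurePreserving π P' P ∧ ∃ (Z : ι → Ω' → ℝ) (Z' : ι' → Ω' → ℝ),
        (∀ i, p i → Z i = Y i ∘ π) ∧ (∀ i, p' i → Z' i = Y' i ∘ π) ∧
        IndepStdGaussianFamilies Z Z' P' := by
  have hind : iIndepFun (fun i : {i // Sum.elim p p' i} => Sum.elim Y Y' i) P := by
    convert (iIndepFun_sumElim h.indep_left h.indep_right h.indep).precomp
      (Equiv.subtypeSum (p := Sum.elim p p')).injective using 2 with i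
    obtain ⟨i | i, hi⟩ := i <;> rfl
  obtain ⟨Ω', mΩ', P', hP', π, hπ, Z, hZ, hZm, hZlaw, hZind⟩ :=
    exists_extension_iIndepFun_hasLaw (fun _ => gaussianReal 0 1) (p := Sum.elim p p')
      (Y := Sum.elim Y Y') (Sum.forall.2 ⟨fun i hi => h.measurable_left ⟨i, hi⟩,
        fun i hi => h.measurable_right ⟨i, hi⟩⟩)
      (Sum.forall.2 ⟨fun i hi => h.law_left ⟨i, hi⟩, fun i hi => h.law_right ⟨i, hi⟩⟩) hind
  rw [← Sum.elim_comp_inl_inr Z] at hZm hZlaw hZind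
  exact ⟨Ω', mΩ', P', hP', π, hπ, fun i => Z (.inl i), fun i => Z (.inr i), fun i => hZ (.inl i),
    fun i => hZ (.inr i), .of_iIndepFun hZm hZlaw hZind⟩

end IndepStdGaussianFamilies

end Independence

section PeriodicExtension

variable {Ω : Type*} [MeasurableSpace Ω] {P : Measure Ω}

namespace MemH

variable {x : I → Ω → ℝ} {Ct : ℝ → ℝ}

theorem memLp_two (hx : MemH x P) (t : I) : MemLp (x t) 2 P :=
  (hx.gaussian.hasGaussianLaw_eval t).memLp_two

/-- The `1`-periodic extension to `ℝ` of a process of class `H`, as a curve in `L²(P)`. -/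
noncomputable def loop (hx : MemH x P) (t : ℝ) : Lp ℝ 2 P :=
  (hx.memLp_two _).toLp (x ⟨Int.fract t, unitInterval.fract_mem t⟩)

theorem loop_ae_eq (hx : MemH x P) (t : I) : hx.loop t =ᵐ[P] x t := by
  refine (MemLp.coeFn_toLp _).trans ?_
  rcases t.2.2.lt_or_eq with ht | ht
  · simp only [Int.fract_eq_self.2 ⟨t.2.1, ht⟩, Subtype.coe_eta, Filter.EventuallyEq.rfl]
  · obtain rfl : t = 1 := Subtype.ext ht
    have fract_eq_zero : (⟨Int.fract ((1 : I) : ℝ), unitInterval.fract_mem _⟩ : I) = 0 :=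
      Subtype.ext (by simp)
    simpa only [fract_eq_zero] using hx.periodic

theorem isGaussianSubspace_span_loop (hx : MemH x P) :
    IsGaussianSubspace (Submodule.span ℝ (Set.range hx.loop)) :=
  isGaussianSubspace_span_toLp
    (hx.gaussian.comp_right fun t : ℝ => ⟨Int.fract t, unitInterval.fract_mem t⟩)
    (fun _ => hx.mean_zero _) fun _ => hx.memLp_two _

variable [IsProbabilityMeasure P]

theorem inner_toLp (hx : MemH x P) (hCt : HasCovariogram x Ct P) (s t : I) :
    inner ℝ ((hx.memLp_two s).toLp (x s)) ((hx.memLp_two t).toLp (x t)) = Ct (t - s) := by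
  rw [inner_toLp_eq_covariance _ _ (hx.mean_zero s), hCt.cov_eq]

theorem covariogram_sub_one (hx : MemH x P) (hCt : HasCovariogram x Ct P) {u : ℝ} (hu : u ∈ I) :
    Ct (u - 1) = Ct u := by
  have endpoints : (hx.memLp_two 0).toLp (x 0) = (hx.memLp_two 1).toLp (x 1) :=
    (MemLp.toLp_eq_toLp_iff _ _).2 hx.periodic
  have h := hx.inner_toLp hCt 0 ⟨u, hu⟩
  rw [endpoints, hx.inner_toLp hCt] at h
  simpa using h

theorem covariogram_zero_eq_one (hx : MemH x P) (hCt : HasCovariogram x Ct P) : Ct 0 = Ct 1 := by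
  simpa using hx.covariogram_sub_one hCt (u := 1) unitInterval.one_mem

theorem covariogram_fract_sub_fract (hx : MemH x P) (hCt : HasCovariogram x Ct P) (s t : ℝ) :
    Ct (Int.fract t - Int.fract s) = Ct (Int.fract (t - s)) := by
  have fract_sub : Int.fract (t - s) = Int.fract (Int.fract t - Int.fract s) :=
    Int.fract_eq_fract.2 ⟨⌊t⌋ - ⌊s⌋, by simp only [Int.fract]; push_cast; ring⟩
  have hs := Int.fract_nonneg s
  have hs' := Int.fract_lt_one s
  have ht := Int.fract_nonneg t
  have ht' := Int.fract_lt_one t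
  rw [fract_sub]
  rcases le_or_gt (Int.fract s) (Int.fract t) with hle | hlt
  · rw [(Int.fract_eq_self (a := Int.fract t - Int.fract s)).2 ⟨by linarith, by linarith⟩]
  · rw [← Int.fract_add_one (Int.fract t - Int.fract s),
      (Int.fract_eq_self (a := Int.fract t - Int.fract s + 1)).2 ⟨by linarith, by linarith⟩,
      ← hx.covariogram_sub_one hCt (u := Int.fract t - Int.fract s + 1)
        ⟨by linarith, by linarith⟩, add_sub_cancel_right]

theorem isStationaryLoop (hx : MemH x P) (hCt : HasCovariogram x Ct P) :
    IsStationaryLoop hx.loop (Ct ∘ Int.fract) where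
  continuous_kernel := (hCt.continuousOn.mono (Set.Icc_subset_Icc_left (by norm_num))).comp_fract''
    (hx.covariogram_zero_eq_one hCt)
  periodic t := by simp only [loop, Int.fract_add_one]
  inner_eq s t := (hx.inner_toLp hCt _ _).trans (hx.covariogram_fract_sub_fract hCt s t)

theorem cosCoeff_comp_fract (hx : MemH x P) (hCt : HasCovariogram x Ct P) (n : ℤ) :
    cosCoeff (Ct ∘ Int.fract) n = cosCoeff Ct n := by
  refine cosCoeff_congr (fun u hu => ?_) n
  rcases hu.2.lt_or_eq with hu1 | rfl
  · rw [Function.comp_apply, Int.fract_eq_self.2 ⟨hu.1, hu1⟩]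
  · rw [Function.comp_apply, Int.fract_one, hx.covariogram_zero_eq_one hCt]

end MemH

end PeriodicExtension

section MeanSquareExpansion

variable {Ω : Type*}

theorem sum_Icc_neg_natCast {M : Type*} [AddCommGroup M] (f : ℤ → M) (N : ℕ) :
    ∑ n ∈ Finset.Icc (-N : ℤ) N, f n = f 0 + ∑ k ∈ Finset.Icc 1 N, (f (-k) + f k) := by
  induction N with
  | zero => simp
  | succ N ih =>
    rw [Nat.cast_succ, Finset.sum_Icc_succ_eq_add_endpoints, ih,
      Finset.sum_Icc_succ_top (Nat.le_add_left 1 N), Nat.cast_succ]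
    abel

theorem trigPartialSum_eq_sum_Icc (c : ℕ → ℝ) (ξ : ℤ → Ω → ℝ) (N : ℕ) (t : I) (ω : Ω) :
    trigPartialSum c (fun k => ξ (-k)) (fun k => ξ k) N t ω =
      ∑ n ∈ Finset.Icc (-N : ℤ) N, trigBasis n t * (c n.natAbs * ξ n ω) := by
  rw [sum_Icc_neg_natCast, trigPartialSum]
  congr 1
  · simp only [trigBasis_zero, Int.natAbs_zero, one_mul, Nat.cast_zero]
  · refine Finset.sum_congr rfl fun k hk => ?_
    have hk0 : k ≠ 0 := Nat.one_le_iff_ne_zero.1 (Finset.mem_Icc.1 hk).1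
    rw [trigBasis_natCast hk0, trigBasis_neg_natCast hk0, Int.natAbs_neg, Int.natAbs_natCast]
    ring

theorem trigPartialSum_congr_comp {Ω' : Type*} {c : ℕ → ℝ} {Y Y' : ℕ → Ω → ℝ}
    {Z Z' : ℕ → Ω' → ℝ} {π : Ω' → Ω} (hZ : ∀ k, 1 ≤ k → c k ≠ 0 → Z k = Y k ∘ π)
    (hZ' : ∀ k, c k ≠ 0 → Z' k = Y' k ∘ π) :
    trigPartialSum c Z Z' = fun n t => trigPartialSum c Y Y' n t ∘ π := by
  ext n t ω
  simp only [trigPartialSum, Function.comp_apply]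
  congr 1
  · by_cases h : c 0 = 0
    · simp only [h, zero_mul]
    · rw [hZ' 0 h, Function.comp_apply]
  · refine Finset.sum_congr rfl fun k hk => ?_
    by_cases h : c k = 0
    · simp only [h, zero_mul]
    · rw [hZ k (Finset.mem_Icc.1 hk).1 h, hZ' k h, Function.comp_apply, Function.comp_apply]

variable [MeasurableSpace Ω] {P : Measure Ω}

theorem tendstoMeanSquareUniformly_of_toLp {S : ℕ → I → Ω → ℝ} {x : I → Ω → ℝ}
    {R : ℕ → I → Lp ℝ 2 P} (hR : ∀ n t, (fun ω => x t ω - S n t ω) =ᵐ[P] R n t)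
    (hlim : TendstoUniformly (fun n t => ‖R n t‖ ^ 2) (fun _ => 0) atTop) :
    TendstoMeanSquareUniformly S x P where
  memLp n t := (memLp_congr_ae (hR n t)).2 (Lp.memLp _)
  tendsto := by
    have integral_eq (n : ℕ) (t : I) : ∫ ω, (x t ω - S n t ω) ^ 2 ∂P = ‖R n t‖ ^ 2 := by
      rw [← real_inner_self_eq_norm_sq, L2.inner_def]
      refine integral_congr_ae ((hR n t).mono fun ω hω => ?_)
      simp only at hω
      simp [hω, sq]
    simpa only [integral_eq] using hlim

namespace TendstoMeanSquareUniformly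

theorem trigPartialSum_normalizedCoeff {x : I → Ω → ℝ} {X : ℝ → Lp ℝ 2 P} {D : ℝ → ℝ}
    (hX : IsStationaryLoop X D) (hxX : ∀ t : I, X t =ᵐ[P] x t) :
    TendstoMeanSquareUniformly (trigPartialSum (fun k => √(cosCoeff D k))
      (fun k => ⇑(normalizedCoeff X D (-k))) (fun k => ⇑(normalizedCoeff X D k))) x P := by
  have sqrt_natAbs (n : ℤ) : √(cosCoeff D n.natAbs) = √(cosCoeff D n) := by
    obtain ⟨k, rfl | rfl⟩ := n.eq_nat_or_neg
    · rw [Int.natAbs_natCast]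
    · rw [Int.natAbs_neg, Int.natAbs_natCast, cosCoeff_even D]
  refine tendstoMeanSquareUniformly_of_toLp
    (R := fun N t => X t - ∑ n ∈ Finset.Icc (-N : ℤ) N, trigBasis n t • curveCoeff X n)
    (fun N t => ?_) ?_
  · filter_upwards [hxX t,
      Lp.coeFn_sub (X t) (∑ n ∈ Finset.Icc (-N : ℤ) N, trigBasis n t • curveCoeff X n),
      coeFn_sum_smul_ae_eq (Finset.Icc (-N : ℤ) N) (trigBasis · t) (curveCoeff X),
      (ae_ball_iff (Finset.Icc (-N : ℤ) N).countable_toSet).2 fun n _ =>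
        Lp.coeFn_smul √(cosCoeff D n) (normalizedCoeff X D n)] with ω hxω hsub hsum hsmul
    rw [hsub, Pi.sub_apply, hxω, hsum,
      trigPartialSum_eq_sum_Icc _ fun n => ⇑(normalizedCoeff X D n)]
    congr 1
    refine Finset.sum_congr rfl fun n hn => ?_
    have h := hsmul n hn
    rw [hX.sqrt_smul_normalizedCoeff] at h
    rw [sqrt_natAbs, h, Pi.smul_apply, smul_eq_mul]
  · have hs (N : ℕ) : ∀ n ∈ Finset.Icc (-N : ℤ) N, -n ∈ Finset.Icc (-N : ℤ) N := fun n hn => by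
      rw [Finset.mem_Icc] at hn ⊢; lia
    simp only [hX.norm_sub_sum_smul_curveCoeff_sq (hs _)]
    have error_tendsto := hX.tendsto_sum_Icc_cosCoeff.const_sub (D 0)
    rw [sub_self] at error_tendsto
    exact error_tendsto.tendstoUniformly_const

theorem comp_measurePreserving {Ω' : Type*} [MeasurableSpace Ω'] {P' : Measure Ω'} {π : Ω' → Ω}
    (hπ : MeasurePreserving π P' P) {S : ℕ → I → Ω → ℝ} {x : I → Ω → ℝ}
    (h : TendstoMeanSquareUniformly S x P) :
    TendstoMeanSquareUniformly (fun n t => S n t ∘ π) (fun t => x t ∘ π) P' where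
  memLp n t := (h.memLp n t).comp_measurePreserving hπ
  tendsto := by
    have integral_comp (n : ℕ) (t : I) : ∫ ω, (x t (π ω) - S n t (π ω)) ^ 2 ∂P' =
        ∫ ω, (x t ω - S n t ω) ^ 2 ∂P := by
      rw [← hπ.map_eq, integral_map hπ.measurable.aemeasurable]
      rw [hπ.map_eq]
      exact (h.memLp n t).1.pow 2
    simpa only [Function.comp_apply, integral_comp] using h.tendsto

end TendstoMeanSquareUniformly

theorem indepStdGaussianFamilies_normalizedCoeff [IsProbabilityMeasure P] {X : ℝ → Lp ℝ 2 P}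
    {D : ℝ → ℝ} (hX : IsStationaryLoop X D)
    (hG : IsGaussianSubspace (Submodule.span ℝ (Set.range X))) :
    IndepStdGaussianFamilies
      (fun k : {k : ℕ // 1 ≤ k ∧ √(cosCoeff D k) ≠ 0} => ⇑(normalizedCoeff X D (-k)))
      (fun k : {k : ℕ // √(cosCoeff D k) ≠ 0} => ⇑(normalizedCoeff X D k)) P := by
  let index : {k : ℕ // 1 ≤ k ∧ √(cosCoeff D k) ≠ 0} ⊕ {k : ℕ // √(cosCoeff D k) ≠ 0} → ℤ :=
    Sum.elim (fun k => -k) (fun k => k)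
  have index_injective : Function.Injective index := by
    rintro (⟨j, hj⟩ | ⟨j, hj⟩) (⟨k, hk⟩ | ⟨k, hk⟩) h <;>
      simp only [index, Sum.elim_inl, Sum.elim_inr] at h
    · obtain rfl : j = k := by lia
      rfl
    · lia
    · lia
    · obtain rfl : j = k := by lia
      rfl
  have sqrt_ne_zero : ∀ i, √(cosCoeff D (index i)) ≠ 0 :=
    Sum.forall.2 ⟨fun k => by simpa only [index, Sum.elim_inl, cosCoeff_even D _] using k.2.2,
      fun k => k.2⟩
  have family_eq : Sum.elim
      (fun k : {k : ℕ // 1 ≤ k ∧ √(cosCoeff D k) ≠ 0} => ⇑(normalizedCoeff X D (-k)))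
      (fun k : {k : ℕ // √(cosCoeff D k) ≠ 0} => ⇑(normalizedCoeff X D k)) =
      fun i => ⇑(normalizedCoeff X D (index i)) := by
    ext (k | k) <;> rfl
  have hcl := hG.topologicalClosure
  have hmem := hX.normalizedCoeff_mem_topologicalClosure_span
  refine .of_iIndepFun ?_ ?_ ?_ <;> rw [family_eq]
  · exact fun i => (Lp.stronglyMeasurable _).measurable
  · exact fun i => hcl.hasLaw_of_norm_eq_one (hmem _) (hX.norm_normalizedCoeff (sqrt_ne_zero i))
  · exact hcl.iIndepFun (fun i => hmem _) fun i j hij =>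
      hX.inner_normalizedCoeff_of_ne (index_injective.ne hij)

end MeanSquareExpansion

theorem theorem2p1 {Ω : Type u} [MeasurableSpace Ω] (P : Measure Ω) [IsProbabilityMeasure P]
    (x : I → Ω → ℝ) (hx : MemH x P) (Ct : ℝ → ℝ) (hCt : HasCovariogram x Ct P) :
    ∃ c : ℕ → ℝ,
      Memℓp c 2 ∧
      (∀ n : ℕ, c n ^ 2 = ∫ s in (0 : ℝ)..1, Ct s * Real.cos (2 * n * Real.pi * s)) ∧
      ∃ Y Y' : ℕ → Ω → ℝ,
        IndepStdGaussianFamilies (fun k : {k : ℕ // 1 ≤ k ∧ c k ≠ 0} => Y k)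
          (fun k : {k : ℕ // c k ≠ 0} => Y' k) P ∧
        TendstoMeanSquareUniformly (trigPartialSum c Y Y') x P ∧
        -- complete sequences, after an extension of the space that leaves those variables fixed
        ∃ (Ω' : Type u) (_ : MeasurableSpace Ω') (P' : Measure Ω') (_ : IsProbabilityMeasure P')
          (π : Ω' → Ω), MeasurePreserving π P' P ∧
          ∃ Z Z' : ℕ → Ω' → ℝ,
            (∀ k, 1 ≤ k → c k ≠ 0 → Z k = Y k ∘ π) ∧
            (∀ k, c k ≠ 0 → Z' k = Y' k ∘ π) ∧
            IndepStdGaussianFamilies Z Z' P' ∧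
            TendstoMeanSquareUniformly (trigPartialSum c Z Z') (fun t => x t ∘ π) P' := by
  let ξ := normalizedCoeff hx.loop (Ct ∘ Int.fract)
  have hX := hx.isStationaryLoop hCt
  have indep := indepStdGaussianFamilies_normalizedCoeff hX hx.isGaussianSubspace_span_loop
  have expansion := TendstoMeanSquareUniformly.trigPartialSum_normalizedCoeff hX hx.loop_ae_eq
  obtain ⟨Ω', mΩ', P', hP', π, hπ, Z, Z', hZ, hZ', indep'⟩ :=
    indep.exists_extension (Y := fun k : ℕ => ξ (-k)) (Y' := fun k : ℕ => ξ k)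
  have partialSum_comp := trigPartialSum_congr_comp (fun k h1 hc => hZ k ⟨h1, hc⟩) hZ'
  refine ⟨_, hX.memℓp_sqrt_cosCoeff, fun n => ?_, fun k => ξ (-k), fun k => ξ k, indep,
    expansion, Ω', mΩ', P', hP', π, hπ, Z, Z', fun k h1 hc => hZ k ⟨h1, hc⟩, hZ', indep', ?_⟩
  · rw [Real.sq_sqrt (hX.cosCoeff_nonneg n), hx.cosCoeff_comp_fract hCt, cosCoeff]
    simp only [Int.cast_natCast]
  · exact partialSum_comp ▸ expansion.comp_measurePreserving hπ
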